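/- An LCL problem $\Pi=(\Sigma_{\mathrm{in}},\Sigma_{\mathrm{out}},C,r)$ with maximum degree $\Delta$ consists of finite label sets $\Sigma_{\mathrm{in}},\Sigma_{\mathrm{out}}$, a radius $r\in\mathbb{N}$, and a finite set $C$ of finite graphs with a center of eccentricity at most $r$, in which every half-edge (pair of a node and an incident edge) carries a label from $\Sigma_{\mathrm{in}}$ and a label from $\Sigma_{\mathrm{out}}$. Its inputs are the finite connected simple graphs of maximum degree at most $\Delta$ with half-edges labeled by $\Sigma_{\mathrm{in}}$; a solution labels the half-edges by $\Sigma_{\mathrm{out}}$ so that the subgraph induced by the nodes at distance at most $r$ from any node, with that node as center, is isomorphic, as a centered labeled graph, to a member of $C$. In a synchronous message-passing algorithm $\mathcal A=(\mathcal A(n))_{n\ge 1}$ all nodes know $n$, an upper bound on the number of nodes. Each node initially knows its degree, the input labels of its half-edges (accessed through arbitrarily numbered ports), and a private value. In each round it sends a message through each port, receives its neighbors' messages and updates its state; local computation is unrestricted. After $t_{\mathcal A}(n)$ rounds it outputs a label for each of its half-edges. The algorithm takes $O(1)$ rounds if $t_{\mathcal A}$ is bounded. A randomized LOCAL algorithm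 has messages of arbitrary size and no identifiers; the private values are independent uniform strings of $h_{\mathcal A}(n)<\infty$ random bits. It solves $\Pi$ with failure probability at most $1/n$ if, for every $n$, the output of $\mathcal A(n)$ on every input with at most $n$ nodes is a solution of $\Pi$ with probability at least $1-1/n$. A deterministic CONGEST algorithm with identifier space of size $n^c$ and bandwidth constant $B$ has messages of at most $B\lceil\log_2 n\rceil$ bits; the private values are identifiers from $\{1,\dots,n^c\}$. It solves $\Pi$ if, for every $n$, the output of $\mathcal A(n)$ is a solution of $\Pi$ on every input with at most $n$ nodes and for every assignment of pairwise distinct identifiers. **Theorem.** Let $\Pi$ be an LCL problem, and assume that there is a randomized LOCAL algorithm that solves $\Pi$ in $O(1)$ rounds with failure probability at most $1/n$. Then, for all integer constants $B\ge c\ge 1$, there is a deterministic CONGEST algorithm with identifier space of size $n^c$ and bandwidth constant $B$ that solves $\Pi$ in $O(1)$ rounds. -/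

import Mathlib

/-! ### Locally checkable labelings

A half-edge `(v, e)` with `v ∈ e = {v, u}` is represented by the dart `(v, u)`. -/

/-- A finite graph with a distinguished vertex, all of whose half-edges carry an input label in `I`
and an output label in `O`. -/
structure CenteredGraph (I O : Type) where
  size : ℕ
  graph : SimpleGraph (Fin size)
  center : Fin size
  input : graph.Dart → I
  output : graph.Dart → O

/-- An LCL problem on graphs of maximum degree at most `maxDegree`, with input labels `I`, output
labels `O`, checkability radius `r` and finite set `C` of allowed labeled balls.
(Finiteness of `I` and `O` is assumed where the structure is used.) -/
structure LCL (I O : Type) where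
  maxDegree : ℕ
  r : ℕ
  C : Set (CenteredGraph I O)
  finite_C : C.Finite
  radius_le : ∀ H ∈ C, ∀ u, H.graph.edist H.center u ≤ r

/-- The vertex set of the radius-`r` ball around `v`. -/
def graphBall {V : Type} (G : SimpleGraph V) (v : V) (r : ℕ) : Set V :=
  {u | G.edist v u ≤ r}

/-- The (induced) radius-`r` ball around `v` in the graph `G` with input labeling `x` and output
labeling `y` is isomorphic, as a centered labeled graph, to `H`. -/
def BallIsomorphic {I O V : Type} (G : SimpleGraph V) (x : G.Dart → I) (y : G.Dart → O)
    (r : ℕ) (v : V) (H : CenteredGraph I O) : Prop :=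
  ∃ φ : H.graph ≃g G.induce (graphBall G v r),
    (φ H.center : V) = v ∧
    ∀ e : H.graph.Dart,
      let e' : G.Dart := ⟨((φ e.fst : V), (φ e.snd : V)), φ.map_adj_iff.2 e.adj⟩
      H.input e = x e' ∧ H.output e = y e'

/-- The output labeling `y` solves the problem on the graph `G` with input labeling `x`. -/
def LCL.IsSolution {I O V : Type} (P : LCL I O) (G : SimpleGraph V)
    (x : G.Dart → I) (y : G.Dart → O) : Prop :=
  ∀ v, ∃ H ∈ P.C, BallIsomorphic G x y P.r v H

/-! ### Networks and synchronous message passing -/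

/-- A graph with input labels on its half-edges, in which each node `v` accesses its incident edges
through ports `0, …, deg v - 1`, numbered arbitrarily. By `port`, the number `deg v` is the degree
of `v`. -/
structure Network (I V : Type) where
  graph : SimpleGraph V
  deg : V → ℕ
  port : ∀ v, Fin (deg v) ≃ graph.neighborSet v
  input : graph.Dart → I

/-- The instances that an algorithm with parameter `n` has to handle: connected graphs with at most
`n` nodes and maximum degree at most `Δ`. -/
def Network.Admissible {I V : Type} (N : Network I V) (Δ n : ℕ) : Prop :=
  Finite V ∧ Nat.card V ≤ n ∧ N.graph.Connected ∧ ∀ v, N.deg v ≤ Δ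

/-- A synchronous message-passing algorithm, run by every node. A node initially knows its degree
`d`, the input labels of its half-edges (by port) and a private value in `S` (its random bits, or
its identifier). In each round it sends a message in `M` through each of its ports, receives the
messages sent to it by its neighbors, and updates its state; after `rounds` rounds it
outputs a label for each of its half-edges. Local computation is unrestricted. -/
structure Algorithm (S I O M : Type) where
  rounds : ℕ
  State : ℕ → Type
  init : ∀ d : ℕ, (Fin d → I) → S → State d
  send : ∀ d : ℕ, State d → Fin d → M
  receive : ∀ d : ℕ, State d → (Fin d → M) → State d
  output : ∀ d : ℕ, State d → Fin d → O

/-- The half-edge of `v` at its port `p`. -/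
def Network.dart {I V : Type} (N : Network I V) (v : V) (p : Fin (N.deg v)) : N.graph.Dart :=
  ⟨(v, (N.port v p : V)), (N.port v p).2⟩

/-- The port of the first endpoint of a half-edge at which that half-edge is attached. -/
def Network.portOf {I V : Type} (N : Network I V) (e : N.graph.Dart) : Fin (N.deg e.fst) :=
  (N.port e.fst).symm ⟨e.snd, e.adj⟩

/-- The state of each node after `t` rounds, where `s` gives the private values of the nodes. The
message that `v` receives at its port `p` is the one that the neighbor `u` at this port sent through
the port of `u` leading back to `v`. -/
def Algorithm.stateAt {S I O M V : Type} (A : Algorithm S I O M) (N : Network I V) (s : V → S) :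
    ℕ → ∀ v : V, A.State (N.deg v)
  | 0, v => A.init (N.deg v) (fun p => N.input (N.dart v p)) (s v)
  | t + 1, v => A.receive (N.deg v) (A.stateAt N s t v) fun p =>
      let e := (N.dart v p).symm
      A.send (N.deg e.fst) (A.stateAt N s t e.fst) (N.portOf e)

/-- The output labeling of the half-edges produced by the algorithm. -/
def Algorithm.result {S I O M V : Type} (A : Algorithm S I O M) (N : Network I V) (s : V → S) :
    N.graph.Dart → O :=
  fun e => A.output (N.deg e.fst) (A.stateAt N s A.rounds e.fst) (N.portOf e)

/-! ### Randomized LOCAL algorithms -/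

/-- A randomized algorithm in the LOCAL model: for each parameter `n` an anonymous message-passing
algorithm with messages from an arbitrary set, in which each node has `bits n` random bits. -/
structure RandomizedLocalAlgorithm (I O : Type) where
  bits : ℕ → ℕ
  Msg : ℕ → Type
  alg : ∀ n, Algorithm (Fin (bits n) → Bool) I O (Msg n)

/-- The probability, over independent uniform random bits of the nodes, that the output of the
algorithm with parameter `n` is not a solution. -/
noncomputable def RandomizedLocalAlgorithm.failureProb {I O V : Type}
    (A : RandomizedLocalAlgorithm I O) (P : LCL I O) (n : ℕ) (N : Network I V) : ℝ :=
  ({ρ : V → Fin (A.bits n) → Bool |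
      ¬ P.IsSolution N.graph N.input ((A.alg n).result N ρ)}.ncard : ℝ) /
    (Nat.card (V → Fin (A.bits n) → Bool) : ℝ)

/-- With parameter `n`, the algorithm fails with probability at most `1 / n` on every graph with at
most `n` nodes. -/
def RandomizedLocalAlgorithm.Solves {I O : Type} (A : RandomizedLocalAlgorithm I O)
    (P : LCL I O) : Prop :=
  ∀ (n : ℕ) (V : Type) (N : Network I V), N.Admissible P.maxDegree n →
    A.failureProb P n N ≤ 1 / (n : ℝ)

/-! ### Deterministic CONGEST algorithms -/

/-- Messages of at most `b` bits. -/
def BitMessage (b : ℕ) : Type := {w : List Bool // w.length ≤ b}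

/-- A deterministic algorithm in the CONGEST model: for each parameter `n`, an algorithm in which
each node has an identifier from a space of size `n ^ c`, and messages have at most
`B * ⌈log₂ n⌉` bits. -/
structure DeterministicCongestAlgorithm (I O : Type) (c B : ℕ) where
  alg : ∀ n, Algorithm (Fin (n ^ c)) I O (BitMessage (B * Nat.clog 2 n))

/-- With parameter `n`, the algorithm is correct on every graph with at most `n` nodes, for every
assignment of unique identifiers. -/
def DeterministicCongestAlgorithm.Solves {I O : Type} {c B : ℕ}
    (D : DeterministicCongestAlgorithm I O c B) (P : LCL I O) : Prop :=
  ∀ (n : ℕ) (V : Type) (N : Network I V), N.Admissible P.maxDegree n →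
    ∀ ident : V → Fin (n ^ c), Function.Injective ident →
      P.IsSolution N.graph N.input ((D.alg n).result N ident)

/-! Fix `n`. Up to renaming nodes there are finitely many instances with at most `n` nodes and
distinct identifiers. Run the randomized algorithm with a parameter `m` exceeding their number: it
fails on each with probability at most `1/m`. If every identifier draws its own random bits,
distinct identifiers make the bits of the nodes independent and uniform, so by the union bound some
fixed map from identifiers to bits succeeds on all instances at once (`exists_bits`). That `m` may
be huge is harmless, since the number of rounds is bounded uniformly.

The result is deterministic but may send long messages. With bounded degree and boundedly many
rounds, a message depends on boundedly many identifiers and a bounded amount of other data, so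
polynomially many messages occur (`ncard_messages_le`). Each is sent in a constant number of pieces
of `B * ⌈log₂ n⌉` bits (`serialize_result`). -/

variable {S I O M Q V W : Type}

/-! ### Invariance under renaming of nodes -/

/-- The half-edge of `G` corresponding to a half-edge of its pullback. -/
def comapDart {G : SimpleGraph V} (e : W ≃ V) (a : (G.comap e).Dart) : G.Dart :=
  ⟨(e a.fst, e a.snd), a.adj⟩

/-- The network obtained by renaming the nodes. -/
def Network.comap (N : Network I V) (e : W ≃ V) : Network I W where
  graph := N.graph.comap e
  deg w := N.deg (e w)
  port w := (N.port (e w)).trans (e.subtypeEquiv fun _ => Iff.rfl).symm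
  input a := N.input (comapDart e a)

theorem Network.comapDart_dart_symm (N : Network I V) (e : W ≃ V) (w : W) (p : Fin (N.deg (e w))) :
    comapDart e ((N.comap e).dart w p).symm = (N.dart (e w) p).symm := by
  ext
  · exact e.apply_symm_apply _
  · rfl

theorem Network.comapDart_dart (N : Network I V) (e : W ≃ V) (w : W) (p : Fin (N.deg (e w))) :
    comapDart e ((N.comap e).dart w p) = N.dart (e w) p := by
  ext
  · rfl
  · exact e.apply_symm_apply _

/-- A run sees only ports, inputs and private values, all of which are transported along `e`. This
reduces arbitrary node types to `Fin k`. -/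
theorem Algorithm.stateAt_comap (A : Algorithm S I O M) (N : Network I V) (e : W ≃ V) (s : V → S)
    (t : ℕ) (w : W) : A.stateAt (N.comap e) (s ∘ e) t w = A.stateAt N s t (e w) := by
  induction t generalizing w with
  | zero =>
    change A.init _ _ _ = A.init _ _ _
    congr 1
    funext p
    exact congrArg N.input (N.comapDart_dart e w p)
  | succ t ih =>
    -- Messages as a function of the half-edge: equality of half-edges then transfers by `congrArg`,
    -- despite the dependent state types.
    let F : N.graph.Dart → M := fun a => A.send (N.deg a.fst) (A.stateAt N s t a.fst) (N.portOf a)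
    change A.receive (N.deg (e w)) _ _ = A.receive (N.deg (e w)) _ _
    rw [ih]
    congr 1
    funext p
    refine Eq.trans ?_ (congrArg F (N.comapDart_dart_symm e w p))
    exact congrArg (fun σ => A.send _ σ _) (ih _)

theorem Algorithm.result_comap (A : Algorithm S I O M) (N : Network I V) (e : W ≃ V) (s : V → S)
    (a : (N.comap e).graph.Dart) :
    A.result (N.comap e) (s ∘ e) a = A.result N s (comapDart e a) :=
  congrArg (fun σ => A.output _ σ _) (A.stateAt_comap N e s _ _)

theorem SimpleGraph.Iso.edist_le {G : SimpleGraph V} {H : SimpleGraph W} (f : G ≃g H) (u v : V) :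
    H.edist (f u) (f v) ≤ G.edist u v :=
  le_iInf fun p => by
    simpa using (SimpleGraph.edist_le (p.map f.toHom))

theorem SimpleGraph.Iso.edist_eq {G : SimpleGraph V} {H : SimpleGraph W} (f : G ≃g H) (u v : V) :
    H.edist (f u) (f v) = G.edist u v :=
  le_antisymm (f.edist_le u v) (by simpa using f.symm.edist_le (f u) (f v))

/-- Balls in a pullback are isomorphic to balls in the original graph. -/
def ballComapIso (G : SimpleGraph V) (e : W ≃ V) (w : W) (r : ℕ) :
    (G.comap e).induce (graphBall (G.comap e) w r) ≃g G.induce (graphBall G (e w) r) where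
  toEquiv := e.subtypeEquiv fun u => by
    have := (SimpleGraph.Iso.comap e G).edist_eq w u
    simp only [SimpleGraph.Iso.comap_apply] at this
    simp only [graphBall, Set.mem_ofPred_eq, this]
  map_rel_iff' := Iff.rfl

theorem LCL.IsSolution.of_comap {P : LCL I O} {G : SimpleGraph V} {x : G.Dart → I}
    {y : G.Dart → O} (e : W ≃ V)
    (h : P.IsSolution (G.comap e) (fun a => x (comapDart e a)) (fun a => y (comapDart e a))) :
    P.IsSolution G x y := by
  intro v
  obtain ⟨w, rfl⟩ := e.surjective v
  obtain ⟨H, hH, φ, hφ, hlab⟩ := h w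
  exact ⟨H, hH, φ.trans (ballComapIso G e w P.r), congrArg e hφ, hlab⟩

theorem Network.Admissible.comap {N : Network I V} {Δ n : ℕ} (h : N.Admissible Δ n) (e : W ≃ V) :
    (N.comap e).Admissible Δ n := by
  obtain ⟨h1, h2, h3, h4⟩ := h
  exact ⟨Finite.of_equiv _ e.symm, (Nat.card_congr e).trans_le h2,
    (SimpleGraph.Iso.connected_iff (SimpleGraph.Iso.comap e N.graph)).2 h3, fun w => h4 (e w)⟩

/-! ### Finiteness of the set of instances -/

theorem Network.deg_eq (N : Network I V) (v : V) : N.deg v = Nat.card (N.graph.neighborSet v) := by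
  rw [← Nat.card_congr (N.port v), Nat.card_fin]

theorem SimpleGraph.Dart.finite [Finite V] (G : SimpleGraph V) : Finite G.Dart :=
  Finite.of_injective _ (SimpleGraph.Dart.toProd_injective (G := G))

theorem Network.finite [Finite V] [Finite I] : Finite (Network I V) := by
  have (G : SimpleGraph V) := SimpleGraph.Dart.finite G
  let F : (Σ G : SimpleGraph V, Σ deg : V → Fin (Nat.card V + 1),
      (∀ v, Fin (deg v) ≃ G.neighborSet v) × (G.Dart → I)) → Network I V :=
    fun a => ⟨a.1, fun v => a.2.1 v, a.2.2.1, a.2.2.2⟩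
  refine Finite.of_surjective F fun N => ?_
  have hd : ∀ v, N.deg v < Nat.card V + 1 := fun v => by
    rw [N.deg_eq, Nat.lt_succ_iff]
    exact Nat.card_le_card_of_injective _ Subtype.val_injective
  exact ⟨⟨N.graph, fun v => ⟨N.deg v, hd v⟩, N.port, N.input⟩, rfl⟩

/-! ### Derandomization by the union bound -/

/-- Restricting a uniformly random function along an injection gives a uniformly random function. -/
theorem ncard_comp_injective {X D : Type} [Finite D] [Finite X] {g : V → D}
    (hg : Function.Injective g) (B : Set (V → X)) :
    {f : D → X | f ∘ g ∈ B}.ncard * Nat.card (V → X) = B.ncard * Nat.card (D → X) := by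
  classical
  -- Splitting `D` into the range of `g` and its complement makes `D → X` a product in which the
  -- event constrains only the first factor.
  let R := ((Set.range g)ᶜ : Set D)
  let e : V ⊕ R ≃ D :=
    ((Equiv.ofInjective g hg).sumCongr (Equiv.refl _)).trans (Equiv.Set.sumCompl (Set.range g))
  let E : (D → X) ≃ (V → X) × (R → X) :=
    (Equiv.arrowCongr e.symm (Equiv.refl X)).trans (Equiv.sumArrowEquivProdArrow V R X)
  have h1 : {f : D → X | f ∘ g ∈ B} = E ⁻¹' (B ×ˢ Set.univ) := by
    ext f
    simp only [Set.mem_ofPred_eq, Set.mem_preimage, Set.mem_prod, Set.mem_univ, and_true]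
    exact Iff.rfl
  rw [h1, Set.ncard_preimage_of_injective_subset_range E.injective (by simp [E.range_eq_univ]),
    Set.ncard_prod, Set.ncard_univ, Nat.card_congr E, Nat.card_prod]
  ring

/-- The union bound for fractions of a finite type. -/
theorem exists_forall_notMem_of_ncard_le {ι F : Type} [Finite ι] [Finite F] [Nonempty F]
    (B : ι → Set F) {n : ℕ} (hn : Nat.card ι < n) (hB : ∀ i, (B i).ncard * n ≤ Nat.card F) :
    ∃ f, ∀ i, f ∉ B i := by
  by_contra! h
  have := Fintype.ofFinite ι
  have hU : (⋃ i, B i) = Set.univ := Set.eq_univ_of_forall fun f => Set.mem_iUnion.2 (h f)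
  have h1 : Nat.card F ≤ ∑ i, (B i).ncard := by
    rw [← Set.ncard_univ, ← hU]
    exact Set.ncard_iUnion_le_of_fintype B
  have h2 : Nat.card F * n ≤ Nat.card ι * Nat.card F := by
    calc Nat.card F * n ≤ (∑ i, (B i).ncard) * n := Nat.mul_le_mul_right _ h1
      _ = ∑ i, (B i).ncard * n := Finset.sum_mul _ _ _
      _ ≤ ∑ _i : ι, Nat.card F := Finset.sum_le_sum fun i _ => hB i
      _ = Nat.card ι * Nat.card F := by simp
  have h3 : 0 < Nat.card F := Nat.card_pos
  nlinarith

theorem RandomizedLocalAlgorithm.Solves.exists_bits [Finite I] {P : LCL I O}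
    {A : RandomizedLocalAlgorithm I O} (hA : A.Solves P) {D : Type} [Finite D] (n : ℕ) :
    ∃ (m : ℕ) (f : D → Fin (A.bits m) → Bool), ∀ (V : Type) (N : Network I V),
      N.Admissible P.maxDegree n → ∀ ident : V → D, Function.Injective ident →
        P.IsSolution N.graph N.input ((A.alg m).result N (f ∘ ident)) := by
  have (k : ℕ) : Finite (Network I (Fin k)) := Network.finite
  let ι := Σ k : Fin (n + 1),
    {a : Network I (Fin k) × (Fin k → D) //
      a.1.Admissible P.maxDegree n ∧ Function.Injective a.2}
  -- Larger than the number of instances, for the union bound, and at least `n`, so that the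
  -- instances stay admissible for `A.alg m`.
  let m := Nat.card ι + n + 1
  have hm : Nat.card ι < m := by omega
  obtain ⟨f, hf⟩ := exists_forall_notMem_of_ncard_le (F := D → Fin (A.bits m) → Bool)
    (fun i : ι => {f | f ∘ i.2.1.2 ∈ {ρ | ¬ P.IsSolution i.2.1.1.graph i.2.1.1.input
      ((A.alg m).result i.2.1.1 ρ)}}) hm (by
    rintro ⟨k, ⟨N, g⟩, hN, hg⟩
    have h1 := hA m (Fin k) N ⟨hN.1, by have := hN.2.1; omega, hN.2.2⟩
    have hm0 : (0 : ℝ) < m := by positivity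
    have hc : 0 < Nat.card (Fin k → Fin (A.bits m) → Bool) := Nat.card_pos
    rw [RandomizedLocalAlgorithm.failureProb, div_le_div_iff₀ (by exact_mod_cast hc) hm0,
      one_mul] at h1
    have h2 := ncard_comp_injective hg {ρ | ¬ P.IsSolution N.graph N.input ((A.alg m).result N ρ)}
    have h3 : {ρ | ¬ P.IsSolution N.graph N.input ((A.alg m).result N ρ)}.ncard * m ≤
      Nat.card (Fin k → Fin (A.bits m) → Bool) := by exact_mod_cast h1
    refine Nat.le_of_mul_le_mul_right ?_ hc
    calc _ = {ρ | ¬ P.IsSolution N.graph N.input ((A.alg m).result N ρ)}.ncard * m *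
          Nat.card (D → Fin (A.bits m) → Bool) := by rw [mul_right_comm, h2]; ring
      _ ≤ _ := by rw [mul_comm (Nat.card (D → _))]; exact Nat.mul_le_mul_right _ h3)
  refine ⟨m, f, fun V N hN ident hid => ?_⟩
  have := hN.1
  let e : Fin (Nat.card V) ≃ V := (Finite.equivFin V).symm
  have := hf ⟨⟨Nat.card V, Nat.lt_succ_iff.2 hN.2.1⟩, ⟨N.comap e, ident ∘ e⟩, hN.comap e,
    hid.comp e.injective⟩
  rw [Set.mem_ofPred_eq, Set.mem_ofPred_eq, not_not] at this
  refine LCL.IsSolution.of_comap e ?_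
  rw [show (fun a => (A.alg m).result N (f ∘ ident) (comapDart e a)) =
    (A.alg m).result (N.comap e) ((f ∘ ident) ∘ e) from
      funext fun a => ((A.alg m).result_comap N e _ a).symm]
  exact this

/-! ### Sending each message in `L` pieces -/

/-- The message received by `v` at its port `p` in round `t + 1`. -/
def Algorithm.received (A : Algorithm S I O M) (N : Network I V) (s : V → S) (t : ℕ) (v : V)
    (p : Fin (N.deg v)) : M :=
  let e := (N.dart v p).symm
  A.send (N.deg e.fst) (A.stateAt N s t e.fst) (N.portOf e)

open Classical in
/-- The algorithm that sends each message `m` of `A` as the sequence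
`enc m 0, …, enc m (L - 1)`. -/
noncomputable def Algorithm.serialize [Inhabited Q] (A : Algorithm S I O M) (L : ℕ)
    (Ms : Set M) (enc : M → ℕ → Q) : Algorithm S I O Q where
  rounds := A.rounds * L
  State d := A.State d × ℕ × (Fin d → ℕ → Q)
  init d x s := (A.init d x s, 0, fun _ _ => default)
  send d σ p := enc (A.send d σ.1 p) σ.2.1
  receive d σ μ :=
    let buf : Fin d → ℕ → Q := fun p => Function.update (σ.2.2 p) σ.2.1 (μ p)
    if σ.2.1 + 1 = L then
      -- Decoding picks any tuple that matches the buffers; it is unique when `enc` is injective on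
      -- `Ms`. The fallback branch never occurs in the runs considered below.
      (if h : ∃ m : Fin d → M, ∀ p, m p ∈ Ms ∧ ∀ i < L, buf p i = enc (m p) i then
        A.receive d σ.1 h.choose else σ.1, 0, buf)
    else (σ.1, σ.2.1 + 1, buf)
  output d σ p := A.output d σ.1 p

/-- The invariant ties round `t * L + j` to round `t` of `A` with `j` pieces buffered. Buffers are
never cleared, so nothing is claimed about entries from `j` on. At `t = A.rounds` only `j = 0` is
covered, as `hMs` says nothing about later messages. -/
theorem Algorithm.serialize_stateAt [Inhabited Q] (A : Algorithm S I O M) {L : ℕ} (hL : 0 < L)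
    {Ms : Set M} {enc : M → ℕ → Q}
    (henc : ∀ m ∈ Ms, ∀ m' ∈ Ms, (∀ i < L, enc m i = enc m' i) → m = m')
    (N : Network I V) (s : V → S)
    (hMs : ∀ t < A.rounds, ∀ v p, A.received N s t v p ∈ Ms)
    (t : ℕ) (ht : t ≤ A.rounds) (j : ℕ) (hj : j < L) (hjt : t < A.rounds ∨ j = 0) (v : V) :
    ((A.serialize L Ms enc).stateAt N s (t * L + j) v).1 = A.stateAt N s t v ∧
    ((A.serialize L Ms enc).stateAt N s (t * L + j) v).2.1 = j ∧
    ∀ p, ∀ i < j, ((A.serialize L Ms enc).stateAt N s (t * L + j) v).2.2 p i =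
      enc (A.received N s t v p) i := by
  obtain ⟨n, hn⟩ : ∃ n, n = t * L + j := ⟨_, rfl⟩
  rw [← hn]
  induction n generalizing t j v with
  | zero =>
    obtain ⟨h1, rfl⟩ : t * L = 0 ∧ j = 0 := by omega
    obtain rfl : t = 0 := by rcases Nat.mul_eq_zero.1 h1 with h | h <;> omega
    exact ⟨rfl, rfl, fun p i hi => absurd hi (Nat.not_lt_zero i)⟩
  | succ n ih =>
    -- All counters agree, so every neighbor sends piece `j'` just when it is stored at index `j'`.
    have key : ∀ t' j', t' < A.rounds → j' < L → n = t' * L + j' → ∀ v p i, i < j' + 1 →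
        Function.update (((A.serialize L Ms enc).stateAt N s n v).2.2 p)
          (((A.serialize L Ms enc).stateAt N s n v).2.1)
          ((A.serialize L Ms enc).received N s n v p) i = enc (A.received N s t' v p) i := by
      intro t' j' ht' hj' hn' v p i hi
      obtain ⟨-, h2, h3⟩ := ih t' ht'.le j' hj' (Or.inl ht') v hn'
      obtain ⟨g1, g2, -⟩ := ih t' ht'.le j' hj' (Or.inl ht') (N.dart v p).symm.fst hn'
      rw [h2]
      rcases Nat.lt_succ_iff_lt_or_eq.1 hi with hi | rfl
      · rw [Function.update_of_ne hi.ne, h3 p i hi]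
      · rw [Function.update_self]
        change enc (A.send _ ((A.serialize L Ms enc).stateAt N s n (N.dart v p).symm.fst).1 _)
          ((A.serialize L Ms enc).stateAt N s n (N.dart v p).symm.fst).2.1 = _
        rw [g1, g2]
        rfl
    rcases j with _ | j
    -- A block has just ended: the preceding round had counter `L - 1`.
    · obtain ⟨t, rfl⟩ : ∃ t', t = t' + 1 := Nat.exists_eq_succ_of_ne_zero (by rintro rfl; omega)
      obtain ⟨l, rfl⟩ : ∃ l, L = l + 1 := Nat.exists_eq_succ_of_ne_zero hL.ne'
      have hn' : n = t * (l + 1) + l := by rw [Nat.add_mul] at hn; omega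
      obtain ⟨h1, h2, -⟩ := ih t (by omega) l (by omega) (Or.inl (by omega)) v hn'
      have hb := key t l (by omega) (by omega) hn' v
      have hex : ∃ m : Fin (N.deg v) → M, ∀ p, m p ∈ Ms ∧ ∀ i < l + 1,
          Function.update (((A.serialize (l + 1) Ms enc).stateAt N s n v).2.2 p)
          (((A.serialize (l + 1) Ms enc).stateAt N s n v).2.1)
          ((A.serialize (l + 1) Ms enc).received N s n v p) i = enc (m p) i :=
        ⟨A.received N s t v, fun p => ⟨hMs t (by omega) v p, hb p⟩⟩
      have hch : hex.choose = A.received N s t v := funext fun p =>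
        henc _ (hex.choose_spec p).1 _ (hMs t (by omega) v p) fun i hi => by
          rw [← (hex.choose_spec p).2 i hi, hb p i hi]
      have hst : (A.serialize (l + 1) Ms enc).stateAt N s (n + 1) v =
          (A.receive _ ((A.serialize (l + 1) Ms enc).stateAt N s n v).1 hex.choose, 0,
            fun p => Function.update (((A.serialize (l + 1) Ms enc).stateAt N s n v).2.2 p)
          (((A.serialize (l + 1) Ms enc).stateAt N s n v).2.1)
          ((A.serialize (l + 1) Ms enc).received N s n v p)) := by
        refine (if_pos (by rw [h2])).trans ?_
        exact congrArg (fun x => (x, _)) (dif_pos hex)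
      rw [hst, hch, h1]
      exact ⟨rfl, rfl, fun p i hi => absurd hi (Nat.not_lt_zero i)⟩
    · have ht' : t < A.rounds := by omega
      obtain ⟨h1, h2, -⟩ := ih t ht j (by omega) (Or.inl ht') v (by omega)
      have hb := key t j ht' (by omega) (by omega) v
      have hst : (A.serialize L Ms enc).stateAt N s (n + 1) v =
          (((A.serialize L Ms enc).stateAt N s n v).1,
            ((A.serialize L Ms enc).stateAt N s n v).2.1 + 1,
            fun p => Function.update (((A.serialize L Ms enc).stateAt N s n v).2.2 p)
          (((A.serialize L Ms enc).stateAt N s n v).2.1)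
          ((A.serialize L Ms enc).received N s n v p)) :=
        if_neg (by rw [h2]; omega)
      rw [hst]
      exact ⟨h1, congrArg (· + 1) h2, hb⟩

theorem Algorithm.serialize_result [Inhabited Q] (A : Algorithm S I O M) {L : ℕ} (hL : 0 < L)
    {Ms : Set M} {enc : M → ℕ → Q}
    (henc : ∀ m ∈ Ms, ∀ m' ∈ Ms, (∀ i < L, enc m i = enc m' i) → m = m')
    (N : Network I V) (s : V → S)
    (hMs : ∀ t < A.rounds, ∀ v p, A.received N s t v p ∈ Ms) :
    (A.serialize L Ms enc).result N s = A.result N s :=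
  funext fun e => congrArg (fun σ => A.output _ σ _)
    (A.serialize_stateAt hL henc N s hMs A.rounds le_rfl 0 hL (Or.inr rfl) e.fst).1

/-! ### Counting reachable states and messages -/

open Classical in
/-- The messages that can be sent by nodes of degree at most `Δ` with states in `R`. -/
noncomputable def Algorithm.messagesOf (A : Algorithm S I O M) (Δ : ℕ)
    (R : ∀ d, Finset (A.State d)) : Finset M :=
  (Finset.range (Δ + 1)).biUnion fun d =>
    ((R d) ×ˢ (Finset.univ : Finset (Fin d))).image fun a => A.send d a.1 a.2

open Classical in
/-- The states that a node of degree `d` can have after `t` rounds, in networks of maximum degree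
at most `Δ`. -/
noncomputable def Algorithm.reach [Fintype S] [Fintype I] (A : Algorithm S I O M) (Δ : ℕ) :
    ℕ → ∀ d, Finset (A.State d)
  | 0, d => Finset.univ.image fun a : (Fin d → I) × S => A.init d a.1 a.2
  | t + 1, d => ((A.reach Δ t d) ×ˢ
      Fintype.piFinset fun _ : Fin d => A.messagesOf Δ (A.reach Δ t)).image
      fun a => A.receive d a.1 a.2

theorem Algorithm.received_mem_messagesOf (A : Algorithm S I O M) {Δ : ℕ} (N : Network I V)
    (s : V → S) (hN : ∀ v, N.deg v ≤ Δ) {R : ∀ d, Finset (A.State d)} {t : ℕ}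
    (hR : ∀ v, A.stateAt N s t v ∈ R (N.deg v)) (v : V) (p : Fin (N.deg v)) :
    A.received N s t v p ∈ A.messagesOf Δ R := by
  classical
  exact Finset.mem_biUnion.2 ⟨_, Finset.mem_range.2 (Nat.lt_succ_of_le (hN _)),
    Finset.mem_image.2 ⟨(A.stateAt N s t (N.dart v p).symm.fst, N.portOf (N.dart v p).symm),
      Finset.mem_product.2 ⟨hR _, Finset.mem_univ _⟩, rfl⟩⟩

theorem Nat.le_pow_self_of_two_le {X : ℕ} (hX : 2 ≤ X) (a : ℕ) : a ≤ X ^ a :=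
  (Nat.lt_pow_self hX).le

/-- A message is determined by a degree, a state and a port; the constant `(Δ + 1) * Δ` is absorbed
via `a ≤ X ^ a`. -/
theorem Algorithm.card_messagesOf_le (A : Algorithm S I O M) {Δ X k : ℕ} (hX : 2 ≤ X)
    {R : ∀ d, Finset (A.State d)} (hR : ∀ d ≤ Δ, (R d).card ≤ X ^ k) :
    (A.messagesOf Δ R).card ≤ X ^ ((Δ + 1) * Δ + k) := by
  classical
  calc (A.messagesOf Δ R).card ≤ (Finset.range (Δ + 1)).card * (X ^ k * Δ) := by
        refine Finset.card_biUnion_le_card_mul _ _ _ fun d hd => Finset.card_image_le.trans ?_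
        have hd : d ≤ Δ := Nat.lt_succ_iff.1 (Finset.mem_range.1 hd)
        rw [Finset.card_product, Finset.card_univ, Fintype.card_fin]
        exact Nat.mul_le_mul (hR d hd) hd
    _ = ((Δ + 1) * Δ) * X ^ k := by rw [Finset.card_range]; ring
    _ ≤ X ^ ((Δ + 1) * Δ) * X ^ k := Nat.mul_le_mul_right _ (Nat.le_pow_self_of_two_le hX _)
    _ = _ := (pow_add _ _ _).symm

section

variable [Fintype S] [Fintype I]

theorem Algorithm.stateAt_mem_reach (A : Algorithm S I O M) {Δ : ℕ} (N : Network I V)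
    (s : V → S) (hN : ∀ v, N.deg v ≤ Δ) (t : ℕ) (v : V) :
    A.stateAt N s t v ∈ A.reach Δ t (N.deg v) := by
  classical
  induction t generalizing v with
  | zero => exact Finset.mem_image.2 ⟨(_, _), Finset.mem_univ _, rfl⟩
  | succ t ih =>
    exact Finset.mem_image.2 ⟨(A.stateAt N s t v, A.received N s t v), Finset.mem_product.2
      ⟨ih v, Fintype.mem_piFinset.2 (A.received_mem_messagesOf N s hN ih v)⟩, rfl⟩

/-- An exponent for a bound on the number of reachable states. -/
def reachExponent (i Δ : ℕ) : ℕ → ℕ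
  | 0 => (i + 1) ^ Δ + 1
  | t + 1 => reachExponent i Δ t + ((Δ + 1) * Δ + reachExponent i Δ t) * Δ

theorem reachExponent_mono (i Δ : ℕ) : Monotone (reachExponent i Δ) :=
  monotone_nat_of_le_succ fun _ => Nat.le_add_right _ _

/-- A new state is determined by the old one and at most `Δ` messages, so each round changes the
exponent by a recursion not involving `X`. -/
theorem Algorithm.card_reach_le (A : Algorithm S I O M) {Δ X : ℕ} (hX : 2 ≤ X)
    (hS : Fintype.card S ≤ X) (t : ℕ) {d : ℕ} (hd : d ≤ Δ) :
    (A.reach Δ t d).card ≤ X ^ reachExponent (Fintype.card I) Δ t := by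
  classical
  induction t generalizing d with
  | zero =>
    refine Finset.card_image_le.trans ?_
    rw [Finset.card_univ, Fintype.card_prod, Fintype.card_fun, Fintype.card_fin, reachExponent,
      pow_succ]
    refine Nat.mul_le_mul (le_trans ?_ (Nat.le_pow_self_of_two_le hX _)) hS
    -- The base `|I| + 1` is positive even for empty `I`, so its powers are monotone in the
    -- exponent.
    exact (Nat.pow_le_pow_left (Nat.le_succ _) d).trans (Nat.pow_le_pow_right (Nat.succ_pos _) hd)
  | succ t ih =>
    refine Finset.card_image_le.trans ?_
    rw [Finset.card_product, Fintype.card_piFinset, Finset.prod_const, Finset.card_univ,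
      Fintype.card_fin, reachExponent, pow_add, pow_mul]
    refine Nat.mul_le_mul (ih hd) ?_
    exact (Nat.pow_le_pow_left (A.card_messagesOf_le hX fun d hd => ih hd) d).trans
      (Nat.pow_le_pow_right (Nat.pow_pos (by omega)) hd)

/-- The messages that can be sent in the first `T` rounds, in networks of maximum degree at most
`Δ`. -/
noncomputable def Algorithm.messages (A : Algorithm S I O M) (Δ T : ℕ) : Set M :=
  ⋃ t : Fin T, (A.messagesOf Δ (A.reach Δ t) : Set M)

theorem Algorithm.finite_messages (A : Algorithm S I O M) (Δ T : ℕ) : (A.messages Δ T).Finite :=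
  Set.finite_iUnion fun _ => Finset.finite_toSet _

theorem Algorithm.messages_zero (A : Algorithm S I O M) (T : ℕ) : A.messages 0 T = ∅ := by
  simp [Algorithm.messages, Algorithm.messagesOf]

theorem Algorithm.ncard_messages_le (A : Algorithm S I O M) {Δ X T : ℕ} (hX : 2 ≤ X)
    (hS : Fintype.card S ≤ X) :
    (A.messages Δ T).ncard ≤
      X ^ (T + ((Δ + 1) * Δ + reachExponent (Fintype.card I) Δ T)) := by
  calc (A.messages Δ T).ncard
      ≤ ∑ t : Fin T, ((A.messagesOf Δ (A.reach Δ t) : Finset M) : Set M).ncard :=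
        Set.ncard_iUnion_le_of_fintype _
    _ ≤ ∑ _t : Fin T, X ^ ((Δ + 1) * Δ + reachExponent (Fintype.card I) Δ T) := by
        refine Finset.sum_le_sum fun t _ => ?_
        rw [Set.ncard_coe_finset]
        refine (A.card_messagesOf_le hX fun d hd => A.card_reach_le hX hS t hd).trans ?_
        exact Nat.pow_le_pow_right (by omega)
          (Nat.add_le_add_left (reachExponent_mono _ _ t.2.le) _)
    _ = T * X ^ ((Δ + 1) * Δ + reachExponent (Fintype.card I) Δ T) := by simp
    _ ≤ X ^ T * X ^ ((Δ + 1) * Δ + reachExponent (Fintype.card I) Δ T) :=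
        Nat.mul_le_mul_right _ (Nat.le_pow_self_of_two_le hX _)
    _ = _ := (pow_add _ _ _).symm

end

/-! ### Encoding messages by bit strings -/

instance (b : ℕ) : Inhabited (BitMessage b) := ⟨⟨[], Nat.zero_le b⟩⟩

/-- The message consisting of `b` given bits. -/
def BitMessage.ofBits {b : ℕ} (w : Fin b → Bool) : BitMessage b :=
  ⟨List.ofFn w, List.length_ofFn.le⟩

theorem BitMessage.ofBits_injective {b : ℕ} :
    Function.Injective (BitMessage.ofBits (b := b)) := fun _ _ h =>
  List.ofFn_injective (congrArg Subtype.val h)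

/-- A finite set of at most `(2 ^ b) ^ L` elements can be encoded by `L` messages of `b` bits. -/
theorem exists_bitMessage_encoding {Ms : Set M} (hMs : Ms.Finite) {b L : ℕ}
    (h : Ms.ncard ≤ (2 ^ b) ^ L) :
    ∃ enc : M → ℕ → BitMessage b,
      ∀ m ∈ Ms, ∀ m' ∈ Ms, (∀ i < L, enc m i = enc m' i) → m = m' := by
  classical
  have := hMs.fintype
  obtain ⟨φ⟩ : Nonempty (Ms ↪ (Fin L → Fin b → Bool)) := by
    refine Function.Embedding.nonempty_of_card_le ?_
    rw [Set.ncard_eq_toFinset_card' Ms, Set.toFinset_card] at h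
    simpa using h
  refine ⟨fun m i => if hm : m ∈ Ms ∧ i < L then
    BitMessage.ofBits (φ ⟨m, hm.1⟩ ⟨i, hm.2⟩) else default,
    fun m hm m' hm' heq => ?_⟩
  have : φ ⟨m, hm⟩ = φ ⟨m', hm'⟩ := funext fun i => by
    have := heq i i.2
    beta_reduce at this
    rw [dif_pos ⟨hm, i.2⟩, dif_pos ⟨hm', i.2⟩] at this
    exact BitMessage.ofBits_injective this
  exact congrArg Subtype.val (φ.injective this)

/-- The algorithm in which the private value is first translated by `f`. -/
def Algorithm.comapPrivate {S' : Type} (A : Algorithm S I O M) (f : S' → S) :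
    Algorithm S' I O M where
  rounds := A.rounds
  State := A.State
  init d x s := A.init d x (f s)
  send := A.send
  receive := A.receive
  output := A.output

theorem Algorithm.result_comapPrivate {S' : Type} (A : Algorithm S I O M) (f : S' → S)
    (N : Network I V) (s : V → S') : (A.comapPrivate f).result N s = A.result N (f ∘ s) := by
  have (t : ℕ) : (A.comapPrivate f).stateAt N s t = A.stateAt N (f ∘ s) t := by
    induction t with
    | zero => rfl
    | succ t ih =>
      funext v
      simp only [Algorithm.stateAt, ih]
      rfl
  funext e
  simp only [Algorithm.result, this]
  rfl

theorem Network.deg_eq_zero (N : Network I V) [Subsingleton V] (v : V) : N.deg v = 0 := by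
  by_contra h
  exact N.graph.ne_of_adj (N.port v ⟨0, Nat.pos_of_ne_zero h⟩).2 (Subsingleton.elim _ _)

/-! ### Simulation in CONGEST and conclusion -/

/-- An algorithm with `T` rounds, private values from a space of size `n ^ c` and messages of
arbitrary size can be simulated in `O(T)` rounds with messages of logarithmic size, if the maximum
degree is bounded. -/
theorem Algorithm.exists_congest [Finite I] (Δ T : ℕ) :
    ∃ L : ℕ, ∀ (c B n : ℕ) (M : Type) (A : Algorithm (Fin (n ^ c)) I O M), 1 ≤ c → c ≤ B →
      A.rounds ≤ T → ∃ D : Algorithm (Fin (n ^ c)) I O (BitMessage (B * Nat.clog 2 n)),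
        D.rounds ≤ T * L ∧ ∀ (V : Type) (N : Network I V), N.Admissible Δ n →
          ∀ s, D.result N s = A.result N s := by
  have := Fintype.ofFinite I
  refine ⟨T + ((Δ + 1) * Δ + reachExponent (Fintype.card I) Δ T) + 1,
    fun c B n M A hc hB hA => ?_⟩
  set L := T + ((Δ + 1) * Δ + reachExponent (Fintype.card I) Δ T) + 1 with hL
  obtain ⟨Δ', hΔ', hcard⟩ : ∃ Δ', (∀ (V : Type) (N : Network I V), N.Admissible Δ n →
      ∀ v, N.deg v ≤ Δ') ∧ (A.messages Δ' T).ncard ≤ (2 ^ (B * Nat.clog 2 n)) ^ L := by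
    -- For `n < 2` the bandwidth is zero, but a network has at most one node and hence no ports:
    -- degree bound `0` leaves no messages to encode.
    rcases Nat.lt_or_ge n 2 with hn | hn
    · refine ⟨0, fun V N hN v => ?_, by simp [A.messages_zero]⟩
      have := hN.1
      have : Subsingleton V := Finite.card_le_one_iff_subsingleton.1 (hN.2.1.trans (by omega))
      exact (N.deg_eq_zero v).le
    · refine ⟨Δ, fun V N hN => hN.2.2.2, ?_⟩
      -- Counting in powers of the number of full-length pieces makes the exponent the number of
      -- pieces needed; `c ≤ B` ensures that `n ^ c` is at most this base.
      have hX : 2 ≤ 2 ^ (B * Nat.clog 2 n) :=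
        Nat.le_self_pow (Nat.mul_pos (by omega) (Nat.clog_pos (by omega) hn)).ne' 2
      refine (A.ncard_messages_le hX ?_).trans (Nat.pow_le_pow_right (by omega) (Nat.le_succ _))
      calc Fintype.card (Fin (n ^ c)) = n ^ c := Fintype.card_fin _
        _ ≤ (2 ^ Nat.clog 2 n) ^ c := Nat.pow_le_pow_left (Nat.le_pow_clog (by omega) n) c
        _ = 2 ^ (c * Nat.clog 2 n) := by rw [← pow_mul, mul_comm]
        _ ≤ _ := Nat.pow_le_pow_right (by omega) (Nat.mul_le_mul_right _ hB)
  obtain ⟨enc, henc⟩ := exists_bitMessage_encoding (A.finite_messages Δ' T) hcard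
  refine ⟨A.serialize L (A.messages Δ' T) enc, Nat.mul_le_mul_right L hA, fun V N hN s =>
    A.serialize_result (Nat.succ_pos _) henc N s fun t ht v p => ?_⟩
  exact Set.mem_iUnion.2 ⟨⟨t, ht.trans_le hA⟩, A.received_mem_messagesOf N s (hΔ' V N hN)
    (A.stateAt_mem_reach N s (hΔ' V N hN) t) v p⟩

theorem mainTheorem5 {I O : Type} [Finite I] [Finite O] (P : LCL I O)
    (hP : ∃ A : RandomizedLocalAlgorithm I O,
      A.Solves P ∧ ∃ T : ℕ, ∀ n, (A.alg n).rounds ≤ T)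
    (c B : ℕ) (hc : 1 ≤ c) (hB : c ≤ B) :
    ∃ D : DeterministicCongestAlgorithm I O c B,
      D.Solves P ∧ ∃ T : ℕ, ∀ n, (D.alg n).rounds ≤ T := by
  obtain ⟨A, hA, T, hT⟩ := hP
  obtain ⟨L, hL⟩ := Algorithm.exists_congest (I := I) (O := O) P.maxDegree T
  -- The map `f n` depends on `n` alone, so nodes can apply it to their identifiers without
  -- communication.
  choose m f hf using fun n => hA.exists_bits (D := Fin (n ^ c)) n
  choose D hDr hD using fun n =>
    hL c B n (A.Msg (m n)) ((A.alg (m n)).comapPrivate (f n)) hc hB (hT (m n))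
  refine ⟨⟨D⟩, fun n V N hN ident hid => ?_, T * L, hDr⟩
  change P.IsSolution N.graph N.input ((D n).result N ident)
  rw [hD n V N hN, Algorithm.result_comapPrivate]
  exact hf n V N hN ident hid
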